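/- Write points of $\mathbb{C}^3\times\mathbb{C}^2$ as $(a,b,c;d,e)$. An (affine) variety is a common zero set of polynomials, a component is a maximal irreducible subvariety, and $\dim$ is the Krull dimension of the coordinate ring. Two varieties $\mathcal X,\mathcal Y\subset\mathbb{C}^3\times\mathbb{C}^2$ of dimensions $m,n$ with $m+n\ge 5$ intersect improperly if some component of $\mathcal X\cap\mathcal Y$ has dimension greater than $m+n-5$. Let $$A=\begin{pmatrix}1&0&0&1&1\\0&1&0&1&1\\0&0&1&1&1\\1&1&1&2&1\\1&1&1&1&2\end{pmatrix},$$ and let the Thomae group $\mathfrak T\subset GL(5,\mathbb{C})$, isomorphic to $S_5$, consist of the matrices $A^{-1}PA$, $P$ a $5\times5$ permutation matrix, acting on row vectors $(a,b,c;d,e)$; thus $\mathfrak T$ permutes the coordinates $(x,y,z;u,v)$ defined by $(a,b,c;d,e)=(x,y,z;u,v)A$. Two $\mathfrak T$-orbits $\mathfrak V,\mathfrak W$ of varieties are said to intersect improperly if some $\mathcal V\in\mathfrak V$ and some $\mathcal W\in\mathfrak W$ intersect improperly. Define: * the Slater orbit: the $\mathfrak T$-orbit of the variety $\{ab+bc+ca=(d-1)(e-1),\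 d+e-a-b-c=2\}$; * the Dixon–Watson–Whipple orbit: the $\mathfrak T$-orbit of the Dixon $3$-plane $\{(a,b,c;\,1+a-b,\,1+a-c)\}$; * for $n\ge1$, the Pfaff–Saalschütz orbit of index $n$: the $\mathfrak T$-orbit of the $3$-plane $\{(-n,a,b;\,c,\,1+a+b-c-n)\}$. All varieties on these orbits have dimension $3$, and: (i) The Slater orbit and the Dixon–Watson–Whipple orbit intersect improperly. In fact the Slater variety and the Dixon $3$-plane displayed above both contain the irreducible $2$-dimensional variety (a $2$-plane) $$\{(2b+2c,\,b,\,c;\ 1+b+2c,\,1+2b+c) : b,c\in\mathbb{C}\},$$ and the corresponding common specialization of the two summation formulas is $${}_3F_2\!\left(\begin{matrix}2b+2c,\ b,\ c\\ 1+b+2c,\ 1+2b+c\end{matrix};1\right)=\frac{\Gamma(1+b+2c)\,\Gamma(1+2b+c)}{\Gamma(1+2b+2c)\,\Gamma(1+b)\,\Gamma(1+c)},$$ valid (with an absolutely convergent series) for all $b,c\in\mathbb{C}$ such that neither $1+b+2c$ nor $1+2b+c$ is a non-positive integer; the right side is read as $0$ if an argument in the denominator is a non-positive integer. (ii) For every integer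 $n\ge1$, the Slater orbit and the Pfaff–Saalschütz orbit of index $n$ do not intersect improperly. (iii) For every integer $n\ge1$, the Dixon–Watson–Whipple orbit and the Pfaff–Saalschütz orbit of index $n$ do not intersect improperly. -/

import Mathlib

open scoped Matrix

noncomputable section

/-! ### Affine varieties in `ℂ³ × ℂ²`

A parameter vector `(α₁, α₂, α₃; β₁, β₂)` is a function `Fin 5 → ℂ`: the entries `0, 1, 2` are the
upper parameters and the entries `3, 4` are the lower ones. -/

/-- A common zero set of polynomials in `(α; β)`. -/
def IsVariety (X : Set (Fin 5 → ℂ)) : Prop :=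
  ∃ I : Ideal (MvPolynomial (Fin 5) ℂ), X = MvPolynomial.zeroLocus ℂ I

/-- A nonempty variety that is not covered by two varieties unless one of them contains it. -/
def IsIrreducibleVariety (X : Set (Fin 5 → ℂ)) : Prop :=
  IsVariety X ∧ X.Nonempty ∧
    ∀ Y Z : Set (Fin 5 → ℂ), IsVariety Y → IsVariety Z → X ⊆ Y ∪ Z → X ⊆ Y ∨ X ⊆ Z

/-- `Z` is an irreducible component of `X`. -/
def IsVarietyComponent (Z X : Set (Fin 5 → ℂ)) : Prop :=
  IsIrreducibleVariety Z ∧ Z ⊆ X ∧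
    ∀ Z' : Set (Fin 5 → ℂ), IsIrreducibleVariety Z' → Z ⊆ Z' → Z' ⊆ X → Z' = Z

/-- The dimension of a variety: the Krull dimension of its coordinate ring. -/
def varietyDim (X : Set (Fin 5 → ℂ)) : WithBot ℕ∞ :=
  ringKrullDim (MvPolynomial (Fin 5) ℂ ⧸ MvPolynomial.vanishingIdeal ℂ X)

/-- Varieties `X`, `Y` of dimensions `m`, `n` (with `m + n ≥ 5`) intersect improperly if some
component of `X ∩ Y` has dimension greater than `m + n - 5`. -/
def IntersectImproperly (X Y : Set (Fin 5 → ℂ)) : Prop :=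
  ∃ Z : Set (Fin 5 → ℂ), IsVarietyComponent Z (X ∩ Y) ∧
    varietyDim X + varietyDim Y < varietyDim Z + 5

/-! ### The Thomae group and its orbits -/

/-- The matrix `A` with `(a, b, c; d, e) = (x, y, z; u, v) A`. -/
def thomaeA : Matrix (Fin 5) (Fin 5) ℂ :=
  !![1, 0, 0, 1, 1;
     0, 1, 0, 1, 1;
     0, 0, 1, 1, 1;
     1, 1, 1, 2, 1;
     1, 1, 1, 1, 2]

/-- The inverse of `A`. -/
def thomaeAInv : Matrix (Fin 5) (Fin 5) ℂ :=
  (1 / 3 : ℂ) •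
  !![ 1, -2, -2,  1,  1;
     -2,  1, -2,  1,  1;
     -2, -2,  1,  1,  1;
      1,  1,  1,  1, -2;
      1,  1,  1, -2,  1]

theorem thomaeA_mul_inv : thomaeA * thomaeAInv = 1 := by
  ext i j
  fin_cases i <;> fin_cases j <;>
    simp [thomaeA, thomaeAInv, Matrix.mul_apply, Fin.sum_univ_five] <;> norm_num

theorem thomaeAInv_mul : thomaeAInv * thomaeA = 1 :=
  mul_eq_one_comm.mp thomaeA_mul_inv

/-- The Thomae group: all permutations of the coordinates `x, y, z, u, v`, written in the
coordinates `(a, b, c; d, e) = (x, y, z; u, v) A`. The matrices act on row vectors. -/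
def thomaeGroup : Subgroup (GL (Fin 5) ℂ) where
  carrier := {T | ∃ σ : Equiv.Perm (Fin 5),
    (T : Matrix (Fin 5) (Fin 5) ℂ) = thomaeAInv * σ.permMatrix ℂ * thomaeA}
  one_mem' := ⟨1, by simp [thomaeAInv_mul]⟩
  mul_mem' := by
    rintro S T ⟨σ, hσ⟩ ⟨τ, hτ⟩
    refine ⟨τ * σ, ?_⟩
    rw [Units.val_mul, hσ, hτ, Matrix.permMatrix_mul]
    calc _ = thomaeAInv * σ.permMatrix ℂ * (thomaeA * thomaeAInv) * τ.permMatrix ℂ * thomaeA := by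
          simp only [Matrix.mul_assoc]
      _ = _ := by simp only [thomaeA_mul_inv, Matrix.mul_one, Matrix.mul_assoc]
  inv_mem' := by
    rintro T ⟨σ, hσ⟩
    refine ⟨σ⁻¹, ?_⟩
    rw [← Units.mul_eq_one_iff_inv_eq, hσ]
    calc _ = thomaeAInv * σ.permMatrix ℂ * (thomaeA * thomaeAInv) * σ⁻¹.permMatrix ℂ *
          thomaeA := by simp only [Matrix.mul_assoc]
      _ = thomaeAInv * (σ.permMatrix ℂ * σ⁻¹.permMatrix ℂ) * thomaeA := by
          simp only [thomaeA_mul_inv, Matrix.mul_one, Matrix.mul_assoc]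
      _ = 1 := by rw [← Matrix.permMatrix_mul]; simp [thomaeAInv_mul]

/-- The orbit of the variety `V` under the Thomae group. -/
def thomaeOrbit (V : Set (Fin 5 → ℂ)) : Set (Set (Fin 5 → ℂ)) :=
  {W | ∃ T ∈ thomaeGroup, W = (fun p => p ᵥ* (T : Matrix (Fin 5) (Fin 5) ℂ)) '' V}

/-- Two orbits intersect improperly if some member of the first and some member of the second
intersect improperly. -/
def OrbitsIntersectImproperly (𝒱 𝒲 : Set (Set (Fin 5 → ℂ))) : Prop :=
  ∃ V ∈ 𝒱, ∃ W ∈ 𝒲, IntersectImproperly V W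

/-! ### The three families of orbits -/

/-- The Slater variety: `ab + bc + ca = (d - 1)(e - 1)` and `d + e - a - b - c = 2`. -/
def slaterVariety : Set (Fin 5 → ℂ) :=
  {p | p 0 * p 1 + p 1 * p 2 + p 2 * p 0 = (p 3 - 1) * (p 4 - 1) ∧
    p 3 + p 4 - p 0 - p 1 - p 2 = 2}

/-- The Dixon `3`-plane: all `(a, b, c; 1 + a - b, 1 + a - c)`. -/
def dixonPlane : Set (Fin 5 → ℂ) :=
  {p | ∃ a b c : ℂ, p = ![a, b, c, 1 + a - b, 1 + a - c]}

/-- The Pfaff–Saalschütz `3`-plane of index `n`: all `(-n, a, b; c, 1 + a + b - c - n)`. -/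
def pfaffSaalschutzPlane (n : ℕ) : Set (Fin 5 → ℂ) :=
  {p | ∃ a b c : ℂ, p = ![-(n : ℂ), a, b, c, 1 + a + b - c - n]}

/-- The Slater orbit. -/
def slaterOrbit : Set (Set (Fin 5 → ℂ)) := thomaeOrbit slaterVariety

/-- The Dixon–Watson–Whipple orbit. -/
def dixonWatsonWhippleOrbit : Set (Set (Fin 5 → ℂ)) := thomaeOrbit dixonPlane

/-- The Pfaff–Saalschütz orbit of index `n`. -/
def pfaffSaalschutzOrbit (n : ℕ) : Set (Set (Fin 5 → ℂ)) :=
  thomaeOrbit (pfaffSaalschutzPlane n)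

/-! ### The common specialization -/

/-- The `k`-th term of the series `₃F₂(p 0, p 1, p 2; p 3, p 4; 1)`; the value of `ascPochhammer`
is the rising factorial. -/
def threeFTwoTerm (p : Fin 5 → ℂ) (k : ℕ) : ℂ :=
  ((ascPochhammer ℂ k).eval (p 0) * (ascPochhammer ℂ k).eval (p 1) *
      (ascPochhammer ℂ k).eval (p 2)) /
    ((ascPochhammer ℂ k).eval (p 3) * (ascPochhammer ℂ k).eval (p 4) * (k.factorial : ℂ))

/-- The parameter vector `(2b + 2c, b, c; 1 + b + 2c, 1 + 2b + c)`. -/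
def overlapPoint (b c : ℂ) : Fin 5 → ℂ :=
  ![2 * b + 2 * c, b, c, 1 + b + 2 * c, 1 + 2 * b + c]

/-- The `2`-plane of all vectors `(2b + 2c, b, c; 1 + b + 2c, 1 + 2b + c)`. -/
def overlapPlane : Set (Fin 5 → ℂ) :=
  {p | ∃ b c : ℂ, p = overlapPoint b c}

end

/-! In the coordinates `q = p ᵥ* thomaeAInv` the Thomae group permutes the entries of `q`, so each
orbit is described by simple equations up to a choice of indices. A Slater variety is a hyperplane
and a quadric determined by a pair of indices (10 cases). A Dixon–Watson–Whipple plane says that two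
disjoint pairs of coordinates each sum to `1 / 3` (15 cases). A Pfaff–Saalschütz plane can be kept
in standard position: `q 0 + q 1 + q 2 = 1` and `q 0 + q 3 + q 4 = -n`.

All varieties have dimension 3, so a proper intersection has components of dimension at most 1. For
(ii) and (iii) this bound is checked case by case: the linear equations are either inconsistent, or
leave a line (Dixon) or a 2-plane on which the quadric does not vanish identically (Slater). See
`coordDim_slaterCoords_inter_le` and `coordDim_dixonCoords_inter_le`.

For (i), on the Dixon plane the linear Slater equation reads `a = 2b + 2c` and then forces the
quadratic one, so the intersection is exactly `overlapPlane`, of dimension 2. The summation there is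
a case of Slater's formula, whose partial sums telescope to a quotient of Pochhammer symbols with a
Gamma limit. -/

/-! ### Dimension, irreducibility and polynomial maps. -/

/-- The Krull dimension of the coordinate ring of a subset of `ℂ^ι`. -/
noncomputable def coordDim {ι : Type*} (X : Set (ι → ℂ)) : WithBot ℕ∞ :=
  ringKrullDim (MvPolynomial ι ℂ ⧸ MvPolynomial.vanishingIdeal ℂ X)

/-- A map between affine spaces given by polynomials. -/
def IsPolyMap {ι κ : Type*} (F : (ι → ℂ) → κ → ℂ) : Prop :=
  ∃ f : κ → MvPolynomial ι ℂ, ∀ x k, F x k = MvPolynomial.aeval x (f k)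

theorem aeval_aeval_eq {ι κ : Type*} (f : κ → MvPolynomial ι ℂ) (x : ι → ℂ)
    (P : MvPolynomial κ ℂ) : MvPolynomial.aeval x (MvPolynomial.aeval f P) =
      MvPolynomial.aeval (fun k => MvPolynomial.aeval x (f k)) P :=
  MvPolynomial.comp_aeval_apply _ _ _

theorem isPolyMap_id {ι : Type*} : IsPolyMap (id : (ι → ℂ) → ι → ℂ) :=
  ⟨MvPolynomial.X, fun x k => by simp⟩

theorem IsPolyMap.comp {ι κ μ : Type*} {G : (κ → ℂ) → μ → ℂ} {F : (ι → ℂ) → κ → ℂ}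
    (hG : IsPolyMap G) (hF : IsPolyMap F) : IsPolyMap (G ∘ F) := by
  obtain ⟨g, hg⟩ := hG
  obtain ⟨f, hf⟩ := hF
  refine ⟨fun m => MvPolynomial.aeval f (g m), fun x m => ?_⟩
  rw [aeval_aeval_eq, Function.comp_apply, hg, show F x = _ from funext (hf x)]

theorem isPolyMap_vecMul {ι κ : Type*} [Fintype ι] (M : Matrix ι κ ℂ) :
    IsPolyMap (fun p : ι → ℂ => p ᵥ* M) :=
  ⟨fun k => ∑ i, MvPolynomial.X i * MvPolynomial.C (M i k), fun x k => by
    simp [Matrix.vecMul, dotProduct]⟩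

theorem isPolyMap_comp_right {ι κ : Type*} (s : κ → ι) :
    IsPolyMap (fun p : ι → ℂ => p ∘ s) :=
  ⟨fun k => MvPolynomial.X (s k), fun x k => by simp⟩

/-- A set that embeds into another one by a polynomial map with a polynomial retraction has at
most its dimension. -/
theorem coordDim_le_of_leftInverse {ι κ : Type*} {X : Set (ι → ℂ)} {Y : Set (κ → ℂ)}
    {F : (ι → ℂ) → κ → ℂ} {G : (κ → ℂ) → ι → ℂ} (hF : IsPolyMap F) (hG : IsPolyMap G)
    (hXY : ∀ x ∈ X, F x ∈ Y) (hGF : ∀ x ∈ X, G (F x) = x) : coordDim X ≤ coordDim Y := by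
  obtain ⟨f, hf⟩ := hF
  obtain ⟨g, hg⟩ := hG
  have hf' : ∀ x, F x = fun k => MvPolynomial.aeval x (f k) := fun x => funext (hf x)
  -- Pullback along `F` maps the coordinate ring of `Y` to that of `X`; pullback along `G` supplies
  -- preimages, so it is surjective.
  refine ringKrullDim_le_of_surjective
    (Ideal.quotientMap (MvPolynomial.vanishingIdeal ℂ X)
      (MvPolynomial.aeval f : MvPolynomial κ ℂ →ₐ[ℂ] MvPolynomial ι ℂ).toRingHom ?_) ?_
  · intro P hP x hx
    have := hP _ (hXY x hx)
    rw [hf', ← aeval_aeval_eq] at this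
    exact this
  · intro q
    obtain ⟨P, rfl⟩ := Ideal.Quotient.mk_surjective q
    refine ⟨Ideal.Quotient.mk _ (MvPolynomial.aeval g P),
      Ideal.quotientMap_mk.trans (Ideal.Quotient.eq.2 ?_)⟩
    intro x hx
    have h1 : (fun i => MvPolynomial.aeval (F x) (g i)) = x := by
      rw [← funext (hg (F x)), hGF x hx]
    rw [hf'] at h1
    change MvPolynomial.aeval x (MvPolynomial.aeval f (MvPolynomial.aeval g P) - P) = 0
    rw [map_sub, aeval_aeval_eq, aeval_aeval_eq, h1, sub_self]

theorem coordDim_mono {ι : Type*} {X Y : Set (ι → ℂ)} (h : X ⊆ Y) : coordDim X ≤ coordDim Y :=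
  coordDim_le_of_leftInverse isPolyMap_id isPolyMap_id (fun _ hx => h hx) fun _ _ => rfl

theorem vanishingIdeal_univ {ι : Type*} :
    MvPolynomial.vanishingIdeal ℂ (Set.univ : Set (ι → ℂ)) = ⊥ := by
  rw [eq_bot_iff]
  intro P hP
  exact MvPolynomial.funext fun x => by simpa [MvPolynomial.aeval_eq_eval] using hP x trivial

theorem coordDim_univ (k : ℕ) : coordDim (Set.univ : Set (Fin k → ℂ)) = k := by
  rw [coordDim, vanishingIdeal_univ,
    ringKrullDim_eq_of_ringEquiv (RingEquiv.quotientBot (MvPolynomial (Fin k) ℂ)),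
    MvPolynomial.ringKrullDim_of_isNoetherianRing]
  simp

/-- The vanishing ideal of a set that is parametrized by polynomials is prime. -/
theorem vanishingIdeal_range_isPrime {ι κ : Type*} {F : (ι → ℂ) → κ → ℂ} (hF : IsPolyMap F) :
    (MvPolynomial.vanishingIdeal ℂ (Set.range F)).IsPrime := by
  obtain ⟨f, hf⟩ := hF
  -- The ideal is the kernel of pullback along `F`, whose target is a polynomial ring and hence a
  -- domain.
  convert! RingHom.ker_isPrime (MvPolynomial.aeval f : MvPolynomial κ ℂ →ₐ[ℂ] MvPolynomial ι ℂ)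
  ext P
  have h : ∀ x, MvPolynomial.aeval (F x) P = MvPolynomial.aeval x (MvPolynomial.aeval f P) := by
    intro x
    rw [aeval_aeval_eq, show F x = _ from funext (hf x)]
  simp only [MvPolynomial.mem_vanishingIdeal_iff, Set.forall_mem_range, RingHom.mem_ker, h]
  refine ⟨fun H => MvPolynomial.funext fun x => ?_, fun H x => ?_⟩
  · rw [map_zero, ← H x, MvPolynomial.aeval_eq_eval]
  · rw [show MvPolynomial.aeval f P = 0 from H, map_zero]

/-- A set inside an irreducible one on which a further polynomial vanishes has smaller
dimension. -/
theorem coordDim_add_one_le {ι : Type*} {X Y : Set (ι → ℂ)} (hXY : X ⊆ Y)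
    (hY : (MvPolynomial.vanishingIdeal ℂ Y).IsPrime) {P : MvPolynomial ι ℂ}
    (hX : ∀ x ∈ X, MvPolynomial.aeval x P = 0) {y : ι → ℂ} (hy : y ∈ Y)
    (hyP : MvPolynomial.aeval y P ≠ 0) : coordDim X + 1 ≤ coordDim Y := by
  refine ringKrullDim_succ_le_of_surjective
    (Ideal.Quotient.factor (MvPolynomial.vanishingIdeal_anti_mono hXY))
    (Ideal.Quotient.factor_surjective _) (r := Ideal.Quotient.mk _ P) ?_ ?_
  · rw [mem_nonZeroDivisors_iff_ne_zero, Ne, Ideal.Quotient.eq_zero_iff_mem]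
    exact fun h => hyP (h y hy)
  · simpa [Ideal.Quotient.eq_zero_iff_mem] using hX

theorem coordDim_add_one_le_card {k : ℕ} {X : Set (Fin k → ℂ)} {P : MvPolynomial (Fin k) ℂ}
    (hX : ∀ x ∈ X, MvPolynomial.aeval x P = 0) {y : Fin k → ℂ}
    (hyP : MvPolynomial.aeval y P ≠ 0) : coordDim X + 1 ≤ k := by
  rw [← coordDim_univ k]
  refine coordDim_add_one_le (Set.subset_univ X) ?_ hX (Set.mem_univ y) hyP
  rw [vanishingIdeal_univ]
  exact Ideal.isPrime_bot

theorem isIrreducibleVariety_of_isPrime {X : Set (Fin 5 → ℂ)} (hX : IsVariety X)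
    (hne : X.Nonempty) (hp : (MvPolynomial.vanishingIdeal ℂ X).IsPrime) :
    IsIrreducibleVariety X := by
  refine ⟨hX, hne, ?_⟩
  rintro Y Z ⟨I, rfl⟩ ⟨J, rfl⟩ hYZ
  by_contra! h
  obtain ⟨⟨y, hy, hyI⟩, z, hz, hzJ⟩ := h.imp Set.not_subset.1 Set.not_subset.1
  simp only [MvPolynomial.mem_zeroLocus_iff, not_forall] at hyI hzJ
  obtain ⟨P, hP, hyP⟩ := hyI
  obtain ⟨Q, hQ, hzQ⟩ := hzJ
  have hmul : P * Q ∈ MvPolynomial.vanishingIdeal ℂ X := by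
    intro x hx
    rcases hYZ hx with h | h
    · rw [map_mul, h P hP, zero_mul]
    · rw [map_mul, h Q hQ, mul_zero]
  rcases hp.mem_or_mem hmul with h | h
  · exact hyP (h y hy)
  · exact hzQ (h z hz)

/-! ### Orbits in the coordinates permuted by the Thomae group. -/

theorem coordDim_image_vecMul {k : ℕ} (T : GL (Fin k) ℂ) (X : Set (Fin k → ℂ)) :
    coordDim ((fun p => p ᵥ* (T : Matrix (Fin k) (Fin k) ℂ)) '' X) = coordDim X := by
  refine le_antisymm
    (coordDim_le_of_leftInverse (isPolyMap_vecMul (T⁻¹ : GL (Fin k) ℂ).1)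
      (isPolyMap_vecMul T.1) ?_ ?_)
    (coordDim_le_of_leftInverse (isPolyMap_vecMul T.1)
      (isPolyMap_vecMul (T⁻¹ : GL (Fin k) ℂ).1) (fun x hx => ⟨x, hx, rfl⟩) ?_)
  · rintro _ ⟨x, hx, rfl⟩
    simpa [Matrix.vecMul_vecMul] using hx
  · rintro _ ⟨x, hx, rfl⟩
    simp [Matrix.vecMul_vecMul]
  · intro x _
    simp [Matrix.vecMul_vecMul]

theorem varietyDim_eq_of_mem_thomaeOrbit {S V : Set (Fin 5 → ℂ)} (hV : V ∈ thomaeOrbit S) :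
    varietyDim V = varietyDim S := by
  obtain ⟨T, -, rfl⟩ := hV
  exact coordDim_image_vecMul T S

theorem self_mem_thomaeOrbit (S : Set (Fin 5 → ℂ)) : S ∈ thomaeOrbit S :=
  ⟨1, one_mem _, by simp⟩

theorem exists_perm_of_mem_thomaeOrbit {S V : Set (Fin 5 → ℂ)} (hV : V ∈ thomaeOrbit S) :
    ∃ σ : Equiv.Perm (Fin 5), ∀ p ∈ V, ((p ᵥ* thomaeAInv) ∘ σ) ᵥ* thomaeA ∈ S := by
  obtain ⟨T, ⟨σ, hσ⟩, rfl⟩ := hV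
  refine ⟨σ, ?_⟩
  rintro _ ⟨s, hs, rfl⟩
  have h : (s ᵥ* (T : Matrix (Fin 5) (Fin 5) ℂ)) ᵥ* thomaeAInv =
      (s ᵥ* thomaeAInv) ∘ σ.symm := by
    rw [hσ, Matrix.vecMul_vecMul, Matrix.mul_assoc, thomaeA_mul_inv, Matrix.mul_one,
      ← Matrix.vecMul_vecMul, Matrix.vecMul_permMatrix]
  simpa [h, Function.comp_assoc, Matrix.vecMul_vecMul, thomaeAInv_mul] using hs

theorem vecMul_thomaeA (q : Fin 5 → ℂ) : q ᵥ* thomaeA =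
    ![q 0 + q 3 + q 4, q 1 + q 3 + q 4, q 2 + q 3 + q 4,
      q 0 + q 1 + q 2 + 2 * q 3 + q 4, q 0 + q 1 + q 2 + q 3 + 2 * q 4] := by
  ext i
  fin_cases i <;> simp [thomaeA, Matrix.vecMul, dotProduct, Fin.sum_univ_five] <;> ring

/-- Given the linear equation, the quadric can be written with squares of single coordinates and `q
3 + q 4` only. This makes it visible that a permutation matters only through the images of 3 and 4.
-/
theorem vecMul_thomaeA_mem_slaterVariety {q : Fin 5 → ℂ} (h : q ᵥ* thomaeA ∈ slaterVariety) :
    q 0 + q 1 + q 2 = 2 ∧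
      (q 3 + q 4 + 1) ^ 2 + 1 + q 3 ^ 2 + q 4 ^ 2 - q 0 ^ 2 - q 1 ^ 2 - q 2 ^ 2 = 0 := by
  rw [vecMul_thomaeA] at h
  obtain ⟨h1, h2⟩ := h
  simp at h1 h2
  have h3 : q 0 + q 1 + q 2 = 2 := by linear_combination h2
  refine ⟨h3, ?_⟩
  grind

theorem vecMul_thomaeA_mem_dixonPlane {q : Fin 5 → ℂ} (h : q ᵥ* thomaeA ∈ dixonPlane) :
    q 1 + q 3 = 1 / 3 ∧ q 2 + q 4 = 1 / 3 := by
  rw [vecMul_thomaeA] at h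
  obtain ⟨a, b, c, h⟩ := h
  have h0 := congrFun h 0
  have h1 := congrFun h 1
  have h2 := congrFun h 2
  have h3 := congrFun h 3
  have h4 := congrFun h 4
  simp at h0 h1 h2 h3 h4
  constructor <;> grind

theorem vecMul_thomaeA_mem_pfaffSaalschutzPlane {n : ℕ} {q : Fin 5 → ℂ}
    (h : q ᵥ* thomaeA ∈ pfaffSaalschutzPlane n) :
    q 0 + q 1 + q 2 = 1 ∧ q 0 + q 3 + q 4 = -n := by
  rw [vecMul_thomaeA] at h
  obtain ⟨a, b, c, h⟩ := h
  have h0 := congrFun h 0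
  have h1 := congrFun h 1
  have h2 := congrFun h 2
  have h3 := congrFun h 3
  have h4 := congrFun h 4
  simp at h0 h1 h2 h3 h4
  constructor <;> grind

/-- In the coordinates permuted by the Thomae group, the intersection of two varieties from two
orbits is an intersection of the first variety, up to a permutation, with the second one. -/
theorem exists_perm_coordDim_le {S S' V W Z : Set (Fin 5 → ℂ)} (hV : V ∈ thomaeOrbit S)
    (hW : W ∈ thomaeOrbit S') (hZ : Z ⊆ V ∩ W) :
    ∃ ρ : Equiv.Perm (Fin 5), varietyDim Z ≤
      coordDim {r : Fin 5 → ℂ | (r ∘ ρ) ᵥ* thomaeA ∈ S ∧ r ᵥ* thomaeA ∈ S'} := by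
  obtain ⟨σ, hσ⟩ := exists_perm_of_mem_thomaeOrbit hV
  obtain ⟨τ, hτ⟩ := exists_perm_of_mem_thomaeOrbit hW
  -- The coordinates `r = (p ᵥ* thomaeAInv) ∘ τ` put the second variety in standard position; only
  -- the relative permutation remains.
  refine ⟨τ⁻¹ * σ, coordDim_le_of_leftInverse
    ((isPolyMap_comp_right τ).comp (isPolyMap_vecMul thomaeAInv))
    ((isPolyMap_vecMul thomaeA).comp (isPolyMap_comp_right τ.symm)) (fun p hp => ⟨?_, ?_⟩)
    fun p hp => ?_⟩
  · convert! hσ p (hZ hp).1 using 2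
    ext i
    simp
  · exact hτ p (hZ hp).2
  · simp [Function.comp_assoc, Matrix.vecMul_vecMul, thomaeAInv_mul]

/-! ### Intersections with a Pfaff–Saalschütz plane. -/

theorem coordDim_le_one_of_line {R : Set (Fin 5 → ℂ)} (i : Fin 5) (α β : Fin 5 → ℂ)
    (h : ∀ r ∈ R, ∀ k, r k = α k + β k * r i) : coordDim R ≤ 1 := by
  have h1 := coordDim_univ 1
  rw [Nat.cast_one] at h1
  rw [← h1]
  exact coordDim_le_of_leftInverse (F := fun r _ => r i) (G := fun t k => α k + β k * t 0)
    ⟨fun _ => MvPolynomial.X i, by simp⟩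
    ⟨fun k => MvPolynomial.C (α k) + MvPolynomial.C (β k) * MvPolynomial.X 0, by simp⟩
    (fun _ _ => trivial) fun r hr => funext fun k => (h r hr k).symm

theorem coordDim_le_one_of_curve {R : Set (Fin 5 → ℂ)} (i j : Fin 5) (α β γ : Fin 5 → ℂ)
    (h : ∀ r ∈ R, ∀ k, r k = α k + β k * r i + γ k * r j) (Q : MvPolynomial (Fin 5) ℂ)
    (hQ : ∀ r ∈ R, MvPolynomial.aeval r Q = 0)
    (hne : ¬ ∀ s t : ℂ, MvPolynomial.aeval (fun k => α k + β k * s + γ k * t) Q = 0) :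
    coordDim R ≤ 1 := by
  push Not at hne
  obtain ⟨s, t, hst⟩ := hne
  let g : Fin 5 → MvPolynomial (Fin 2) ℂ := fun k => MvPolynomial.C (α k) +
    MvPolynomial.C (β k) * MvPolynomial.X 0 + MvPolynomial.C (γ k) * MvPolynomial.X 1
  have hg : ∀ x : Fin 2 → ℂ, (fun k => MvPolynomial.aeval x (g k)) =
      fun k => α k + β k * x 0 + γ k * x 1 := fun x => by simp [g]
  have hle : coordDim R ≤
      coordDim {x : Fin 2 → ℂ | MvPolynomial.aeval x (MvPolynomial.aeval g Q) = 0} := by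
    refine coordDim_le_of_leftInverse (F := fun r => ![r i, r j])
      (G := fun x k => α k + β k * x 0 + γ k * x 1)
      ⟨![MvPolynomial.X i, MvPolynomial.X j], fun r k => by fin_cases k <;> simp⟩
      ⟨g, fun x k => (congrFun (hg x) k).symm⟩ (fun r hr => ?_)
      fun r hr => funext fun k => (h r hr k).symm
    rw [Set.mem_ofPred_eq, aeval_aeval_eq, hg, ← hQ r hr]
    exact congrArg (fun v => MvPolynomial.aeval v Q) (funext fun k => (h r hr k).symm)
  -- Pulled back to the parameter plane, `Q` is a nonzero polynomial in two variables, so its zero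
  -- set has dimension at most 1.
  have h2 := coordDim_add_one_le_card (k := 2)
    (P := MvPolynomial.aeval g Q) (fun x hx => hx) (y := ![s, t])
    (by rw [aeval_aeval_eq, hg]; exact hst)
  refine hle.trans ?_
  rw [show ((2 : ℕ) : WithBot ℕ∞) = 1 + 1 by norm_num] at h2
  exact (ENat.WithBot.add_le_add_one_right_iff).1 h2

/-- The equations of a Pfaff–Saalschütz plane, in the coordinates permuted by the Thomae group. -/
def pfaffSaalschutzCoords (n : ℕ) : Set (Fin 5 → ℂ) :=
  {r | r 0 + r 1 + r 2 = 1 ∧ r 0 + r 3 + r 4 = -n}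

/-- The equations of a variety on the Slater orbit, in the coordinates permuted by the Thomae
group. -/
def slaterCoords (a b : Fin 5) : Set (Fin 5 → ℂ) :=
  {r | ∑ i, r i - r a - r b = 2 ∧
    (r a + r b + 1) ^ 2 + 1 + 2 * r a ^ 2 + 2 * r b ^ 2 - ∑ i, r i ^ 2 = 0}

theorem slaterCoords_comm (a b : Fin 5) : slaterCoords a b = slaterCoords b a := by
  ext r
  constructor <;> rintro ⟨h1, h2⟩ <;>
    exact ⟨by linear_combination h1, by linear_combination h2⟩

/-- The polynomial that cuts out a variety on the Slater orbit in its hyperplane. -/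
noncomputable def slaterQuadric (a b : Fin 5) : MvPolynomial (Fin 5) ℂ :=
  (MvPolynomial.X a + MvPolynomial.X b + 1) ^ 2 + 1 + 2 * MvPolynomial.X a ^ 2 +
    2 * MvPolynomial.X b ^ 2 - ∑ i, MvPolynomial.X i ^ 2

theorem aeval_slaterQuadric (a b : Fin 5) (r : Fin 5 → ℂ) :
    MvPolynomial.aeval r (slaterQuadric a b) =
      (r a + r b + 1) ^ 2 + 1 + 2 * r a ^ 2 + 2 * r b ^ 2 - ∑ i, r i ^ 2 := by
  simp [slaterQuadric, map_ofNat]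

theorem coordDim_slaterCoords_inter_le_aux (n : ℕ) {a b : Fin 5} (hab : a < b) :
    coordDim (slaterCoords a b ∩ pfaffSaalschutzCoords n) ≤ 1 := by
  have hn : (n : ℂ) + 1 ≠ 0 := Nat.cast_add_one_ne_zero n
  have hn2 : (n : ℂ) + 2 ≠ 0 := by exact_mod_cast (n + 1).succ_ne_zero
  have key : ∀ (i j : Fin 5) (α β γ : Fin 5 → ℂ),
      (∀ r : Fin 5 → ℂ, r 0 + r 1 + r 2 = 1 → r 0 + r 3 + r 4 = -n →
        ∑ i, r i - r a - r b = 2 → ∀ k, r k = α k + β k * r i + γ k * r j) →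
      (¬ ∀ s t : ℂ, MvPolynomial.aeval (fun k => α k + β k * s + γ k * t)
        (slaterQuadric a b) = 0) →
      coordDim (slaterCoords a b ∩ pfaffSaalschutzCoords n) ≤ 1 := by
    intro i j α β γ h hne
    refine coordDim_le_one_of_curve i j α β γ (fun r hr => h r hr.2.1 hr.2.2 hr.1.1)
      (slaterQuadric a b) (fun r hr => ?_) hne
    rw [aeval_slaterQuadric]
    exact hr.1.2
  have hcases : ∀ a b : Fin 5, a < b → (a, b) ∈ [((0 : Fin 5), (1 : Fin 5)), (0, 2), (0, 3),
      (0, 4), (1, 2), (1, 3), (1, 4), (2, 3), (2, 4), (3, 4)] := by decide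
  have hc := hcases a b hab
  simp only [List.mem_cons, Prod.mk.injEq, List.not_mem_nil, or_false] at hc
  simp only [aeval_slaterQuadric, Fin.sum_univ_five] at key
  rcases hc with ⟨rfl, rfl⟩ | ⟨rfl, rfl⟩ | ⟨rfl, rfl⟩ | ⟨rfl, rfl⟩ | ⟨rfl, rfl⟩ | ⟨rfl, rfl⟩ |
      ⟨rfl, rfl⟩ | ⟨rfl, rfl⟩ | ⟨rfl, rfl⟩ | ⟨rfl, rfl⟩ <;>
    -- Each entry solves the three linear equations in terms of two coordinates. For the pairs `(1,
    -- 2)` and `(3, 4)` they are inconsistent (`2 = -n`, respectively `2 = 1`), so the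
    -- parametrization is vacuous and zero vectors serve.
    [refine key 0 3 ![0, -n - 1, 2 + n, 0, -n] ![1, -2, 1, 0, -1] ![0, 0, 0, 1, -1] ?_ ?_;
     refine key 0 3 ![0, 2 + n, -n - 1, 0, -n] ![1, 1, -2, 0, -1] ![0, 0, 0, 1, -1] ?_ ?_;
     refine key 0 1 ![0, 0, 1, -n - 1, 1] ![1, 0, -1, -2, 1] ![0, 1, -1, 0, 0] ?_ ?_;
     refine key 0 1 ![0, 0, 1, 1, -n - 1] ![1, 0, -1, 1, -2] ![0, 1, -1, 0, 0] ?_ ?_;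
     refine key 0 0 0 0 0 ?_ ?_;
     refine key 0 2 ![0, 1, 0, -n - 2, 2] ![1, -1, 0, 0, -1] ![0, -1, 1, 1, -1] ?_ ?_;
     refine key 0 2 ![0, 1, 0, 2, -n - 2] ![1, -1, 0, -1, 0] ![0, -1, 1, -1, 1] ?_ ?_;
     refine key 0 1 ![0, 0, 1, -n - 2, 2] ![1, 0, -1, 0, -1] ![0, 1, -1, 1, -1] ?_ ?_;
     refine key 0 1 ![0, 0, 1, 2, -n - 2] ![1, 0, -1, -1, 0] ![0, 1, -1, -1, 1] ?_ ?_;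
     refine key 0 0 0 0 0 ?_ ?_]
  all_goals first
    | intro r h1 h2 h3 k
      fin_cases k <;> simp <;> grind
    -- Five values detect a nonzero quadric. If the pair contains 0, the coefficient of `t ^ 2` is
    -- `-2`. If it has one index from `{1, 2}` and one from `{3, 4}`, the quadratic part cancels and
    -- the constant term is `2 * (n + 1) ^ 2`, nonzero because `n ≠ -1`.
    | intro h
      have h0 := h 0 0
      have h1 := h 1 0
      have h2 := h (-1) 0
      have h3 := h 0 1
      have h4 := h 0 (-1)
      simp at h0 h1 h2 h3 h4
      try grind

theorem coordDim_slaterCoords_inter_le (n : ℕ) {a b : Fin 5} (hab : a ≠ b) :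
    coordDim (slaterCoords a b ∩ pfaffSaalschutzCoords n) ≤ 1 := by
  rcases hab.lt_or_gt with h | h
  · exact coordDim_slaterCoords_inter_le_aux n h
  · rw [slaterCoords_comm]
    exact coordDim_slaterCoords_inter_le_aux n h

/-- The equations of a plane on the Dixon–Watson–Whipple orbit, in the coordinates permuted by the
Thomae group. -/
def dixonCoords (a b c d : Fin 5) : Set (Fin 5 → ℂ) :=
  {r | r a + r b = 1 / 3 ∧ r c + r d = 1 / 3}

theorem dixonCoords_swap_left (a b c d : Fin 5) : dixonCoords a b c d = dixonCoords b a c d := by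
  ext r
  simp only [dixonCoords, Set.mem_ofPred_eq, add_comm]

theorem dixonCoords_swap_pairs (a b c d : Fin 5) :
    dixonCoords a b c d = dixonCoords c d a b := by
  ext r
  simp only [dixonCoords, Set.mem_ofPred_eq, and_comm]

theorem coordDim_dixonCoords_inter_le_aux (n : ℕ) {a b c d : Fin 5} (hab : a < b) (hcd : c < d)
    (hac : a < c) (hbc : b ≠ c) (hbd : b ≠ d) :
    coordDim (dixonCoords a b c d ∩ pfaffSaalschutzCoords n) ≤ 1 := by
  have hn : (n : ℂ) + 1 ≠ 0 := Nat.cast_add_one_ne_zero n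
  have key : ∀ (i : Fin 5) (α β : Fin 5 → ℂ),
      (∀ r : Fin 5 → ℂ, r 0 + r 1 + r 2 = 1 → r 0 + r 3 + r 4 = -n →
        r a + r b = 1 / 3 → r c + r d = 1 / 3 → ∀ k, r k = α k + β k * r i) →
      coordDim (dixonCoords a b c d ∩ pfaffSaalschutzCoords n) ≤ 1 := fun i α β h =>
    coordDim_le_one_of_line i α β fun r hr => h r hr.2.1 hr.2.2 hr.1.1 hr.1.2
  have hcases : ∀ a b c d : Fin 5, a < b → c < d → a < c → b ≠ c → b ≠ d →
      (a, b, c, d) ∈ [((0 : Fin 5), (1 : Fin 5), (2 : Fin 5), (3 : Fin 5)), (0, 1, 2, 4),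
        (0, 1, 3, 4), (0, 2, 1, 3), (0, 2, 1, 4), (0, 2, 3, 4), (0, 3, 1, 2), (0, 3, 1, 4),
        (0, 3, 2, 4), (0, 4, 1, 2), (0, 4, 1, 3), (0, 4, 2, 3), (1, 2, 3, 4), (1, 3, 2, 4),
        (1, 4, 2, 3)] := by decide
  have hc := hcases a b c d hab hcd hac hbc hbd
  simp only [List.mem_cons, Prod.mk.injEq, List.not_mem_nil, or_false] at hc
  rcases hc with ⟨rfl, rfl, rfl, rfl⟩ | ⟨rfl, rfl, rfl, rfl⟩ | ⟨rfl, rfl, rfl, rfl⟩ |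
      ⟨rfl, rfl, rfl, rfl⟩ | ⟨rfl, rfl, rfl, rfl⟩ | ⟨rfl, rfl, rfl, rfl⟩ | ⟨rfl, rfl, rfl, rfl⟩ |
      ⟨rfl, rfl, rfl, rfl⟩ | ⟨rfl, rfl, rfl, rfl⟩ | ⟨rfl, rfl, rfl, rfl⟩ | ⟨rfl, rfl, rfl, rfl⟩ |
      ⟨rfl, rfl, rfl, rfl⟩ | ⟨rfl, rfl, rfl, rfl⟩ | ⟨rfl, rfl, rfl, rfl⟩ |
      ⟨rfl, rfl, rfl, rfl⟩ <;>
    -- Each entry solves the four linear equations in terms of one coordinate. Only the pairs `{1,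
    -- 2}`, `{3, 4}` are inconsistent: they give both `r 0 = 2 / 3` and `r 0 = -n - 1 / 3`.
    [refine key 0 ![0, 1 / 3, 2 / 3, -1 / 3, 1 / 3 - n] ![1, -1, 0, 0, -1] ?_;
     refine key 0 ![0, 1 / 3, 2 / 3, 1 / 3 - n, -1 / 3] ![1, -1, 0, -1, 0] ?_;
     refine key 3 ![-n - 1 / 3, 2 / 3 + n, 2 / 3, 0, 1 / 3] ![0, 0, 0, 1, -1] ?_;
     refine key 0 ![0, 2 / 3, 1 / 3, -1 / 3, 1 / 3 - n] ![1, 0, -1, 0, -1] ?_;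
     refine key 0 ![0, 2 / 3, 1 / 3, 1 / 3 - n, -1 / 3] ![1, 0, -1, -1, 0] ?_;
     refine key 3 ![-n - 1 / 3, 2 / 3, 2 / 3 + n, 0, 1 / 3] ![0, 0, 0, 1, -1] ?_;
     refine key 1 ![2 / 3, 0, 1 / 3, -1 / 3, -n - 1 / 3] ![0, 1, -1, 0, 0] ?_;
     refine key 0 ![0, 2 / 3 + n, 1 / 3 - n, 1 / 3, -n - 1 / 3] ![1, 0, -1, -1, 0] ?_;
     refine key 0 ![0, 1 / 3 - n, 2 / 3 + n, 1 / 3, -n - 1 / 3] ![1, -1, 0, -1, 0] ?_;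
     refine key 1 ![2 / 3, 0, 1 / 3, -n - 1 / 3, -1 / 3] ![0, 1, -1, 0, 0] ?_;
     refine key 0 ![0, 2 / 3 + n, 1 / 3 - n, -n - 1 / 3, 1 / 3] ![1, 0, -1, 0, -1] ?_;
     refine key 0 ![0, 1 / 3 - n, 2 / 3 + n, -n - 1 / 3, 1 / 3] ![1, -1, 0, 0, -1] ?_;
     refine key 0 0 0 ?_;
     refine key 1 ![1 / 6 - n / 2, 0, 5 / 6 + n / 2, 1 / 3, -1 / 2 - n / 2] ![0, 1, -1, -1, 1] ?_;
     refine key 1 ![1 / 6 - n / 2, 0, 5 / 6 + n / 2, -1 / 2 - n / 2, 1 / 3] ![0, 1, -1, 1, -1] ?_]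
  all_goals
    intro r h1 h2 h3 h4 k
    fin_cases k <;> simp <;> grind

theorem coordDim_dixonCoords_inter_le (n : ℕ) {a b c d : Fin 5} (hab : a ≠ b) (hac : a ≠ c)
    (had : a ≠ d) (hbc : b ≠ c) (hbd : b ≠ d) (hcd : c ≠ d) :
    coordDim (dixonCoords a b c d ∩ pfaffSaalschutzCoords n) ≤ 1 := by
  wlog h1 : a < b generalizing a b
  · rw [dixonCoords_swap_left]
    exact this hab.symm hbc hbd hac had (hab.lt_or_gt.resolve_left h1)
  have aux : ∀ {a b c d : Fin 5}, a < b → c < d → a ≠ c → a ≠ d → b ≠ c → b ≠ d →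
      coordDim (dixonCoords a b c d ∩ pfaffSaalschutzCoords n) ≤ 1 := by
    intro a b c d h1 h2 hac had hbc hbd
    rcases hac.lt_or_gt with h3 | h3
    · exact coordDim_dixonCoords_inter_le_aux n h1 h2 h3 hbc hbd
    · rw [dixonCoords_swap_pairs]
      exact coordDim_dixonCoords_inter_le_aux n h2 h1 h3 had.symm hbd.symm
  rcases hcd.lt_or_gt with h2 | h2
  · exact aux h1 h2 hac had hbc hbd
  · rw [dixonCoords_swap_pairs, dixonCoords_swap_left, dixonCoords_swap_pairs]
    exact aux h1 h2 had hac hbd hbc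

/-! ### Dimensions of the three varieties and of the overlap. -/

theorem coordDim_range {k : ℕ} {G : (Fin k → ℂ) → Fin 5 → ℂ} {F : (Fin 5 → ℂ) → Fin k → ℂ}
    (hG : IsPolyMap G) (hF : IsPolyMap F) (hFG : ∀ t, F (G t) = t) :
    coordDim (Set.range G) = k := by
  rw [← coordDim_univ k]
  refine le_antisymm (coordDim_le_of_leftInverse hF hG (fun _ _ => trivial) ?_)
    (coordDim_le_of_leftInverse hG hF (fun t _ => ⟨t, rfl⟩) fun t _ => hFG t)
  rintro _ ⟨t, rfl⟩
  rw [hFG]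

theorem varietyDim_dixonPlane : varietyDim dixonPlane = 3 := by
  have h : dixonPlane = Set.range fun t : Fin 3 → ℂ =>
      ![t 0, t 1, t 2, 1 + t 0 - t 1, 1 + t 0 - t 2] := by
    ext p
    exact ⟨fun ⟨a, b, c, h⟩ => ⟨![a, b, c], h.symm⟩, fun ⟨t, h⟩ => ⟨t 0, t 1, t 2, h.symm⟩⟩
  rw [h]
  exact coordDim_range (F := fun p => ![p 0, p 1, p 2])
    ⟨![.X 0, .X 1, .X 2, 1 + .X 0 - .X 1, 1 + .X 0 - .X 2], fun x k => by fin_cases k <;> simp⟩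
    ⟨![.X 0, .X 1, .X 2], fun x k => by fin_cases k <;> simp⟩
    fun t => by ext k; fin_cases k <;> simp

theorem varietyDim_pfaffSaalschutzPlane (n : ℕ) : varietyDim (pfaffSaalschutzPlane n) = 3 := by
  have h : pfaffSaalschutzPlane n = Set.range fun t : Fin 3 → ℂ =>
      ![-(n : ℂ), t 0, t 1, t 2, 1 + t 0 + t 1 - t 2 - n] := by
    ext p
    exact ⟨fun ⟨a, b, c, h⟩ => ⟨![a, b, c], h.symm⟩, fun ⟨t, h⟩ => ⟨t 0, t 1, t 2, h.symm⟩⟩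
  rw [h]
  exact coordDim_range (F := fun p => ![p 1, p 2, p 3])
    ⟨![-n, .X 0, .X 1, .X 2, 1 + .X 0 + .X 1 - .X 2 - n], fun x k => by fin_cases k <;> simp⟩
    ⟨![.X 1, .X 2, .X 3], fun x k => by fin_cases k <;> simp⟩
    fun t => by ext k; fin_cases k <;> simp

theorem overlapPlane_eq_range :
    overlapPlane = Set.range fun t : Fin 2 → ℂ => overlapPoint (t 0) (t 1) := by
  ext p
  exact ⟨fun ⟨b, c, h⟩ => ⟨![b, c], h.symm⟩, fun ⟨t, h⟩ => ⟨t 0, t 1, h.symm⟩⟩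

theorem isPolyMap_overlapPoint :
    IsPolyMap fun t : Fin 2 → ℂ => overlapPoint (t 0) (t 1) :=
  ⟨![2 * .X 0 + 2 * .X 1, .X 0, .X 1, 1 + .X 0 + 2 * .X 1, 1 + 2 * .X 0 + .X 1],
    fun x k => by fin_cases k <;> simp [overlapPoint, map_ofNat]⟩

theorem varietyDim_overlapPlane : varietyDim overlapPlane = 2 := by
  rw [overlapPlane_eq_range]
  exact coordDim_range (F := fun p => ![p 1, p 2]) isPolyMap_overlapPoint
    ⟨![.X 1, .X 2], fun x k => by fin_cases k <;> simp⟩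
    fun t => by ext k; fin_cases k <;> simp [overlapPoint]

theorem isIrreducibleVariety_overlapPlane : IsIrreducibleVariety overlapPlane := by
  refine isIrreducibleVariety_of_isPrime ?_ ⟨_, 0, 0, rfl⟩ ?_
  · refine ⟨Ideal.span {.X 0 - 2 * .X 1 - 2 * .X 2, .X 3 - 1 - .X 1 - 2 * .X 2,
      .X 4 - 1 - 2 * .X 1 - .X 2}, ?_⟩
    rw [MvPolynomial.zeroLocus_span]
    ext p
    simp only [Set.mem_ofPred_eq, Set.mem_insert_iff, Set.mem_singleton_iff, forall_eq_or_imp,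
      forall_eq, map_sub, map_mul, MvPolynomial.aeval_X, map_ofNat, map_one]
    constructor
    · rintro ⟨b, c, rfl⟩
      refine ⟨?_, ?_, ?_⟩ <;> simp [overlapPoint] <;> ring
    · rintro ⟨h0, h3, h4⟩
      refine ⟨p 1, p 2, ?_⟩
      ext k
      fin_cases k <;> simp [overlapPoint]
      · linear_combination h0
      · linear_combination h3
      · linear_combination h4
  · rw [overlapPlane_eq_range]
    exact vanishingIdeal_range_isPrime isPolyMap_overlapPoint

theorem slaterVariety_inter_dixonPlane : slaterVariety ∩ dixonPlane = overlapPlane := by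
  ext p
  constructor
  · rintro ⟨⟨h1, h2⟩, a, b, c, rfl⟩
    simp at h1 h2
    refine ⟨b, c, ?_⟩
    have ha : a = 2 * b + 2 * c := by linear_combination h2
    ext k
    fin_cases k <;> simp [overlapPoint, ha] <;> ring
  · rintro ⟨b, c, rfl⟩
    refine ⟨⟨?_, ?_⟩, 2 * b + 2 * c, b, c, ?_⟩
    · simp [overlapPoint]
      ring
    · simp [overlapPoint]
      ring
    · ext k
      fin_cases k <;> simp [overlapPoint] <;> ring

/-- The Slater variety is the image of the quadric `PQ = bc` under this affine map of
`(P, Q, b, c)`. -/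
def slaterMap (y : Fin 4 → ℂ) : Fin 5 → ℂ :=
  ![y 2 + y 3 - y 0 - y 1, y 2, y 3, 1 + y 2 + y 3 - y 1, 1 + y 2 + y 3 - y 0]

theorem isPolyMap_slaterMap : IsPolyMap slaterMap :=
  ⟨![.X 2 + .X 3 - .X 0 - .X 1, .X 2, .X 3, 1 + .X 2 + .X 3 - .X 1, 1 + .X 2 + .X 3 - .X 0],
    fun x k => by fin_cases k <;> simp [slaterMap]⟩

/-- The inverse of `slaterMap` on the Slater variety. -/
def slaterInv (p : Fin 5 → ℂ) : Fin 4 → ℂ :=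
  ![p 3 - 1 - p 0, p 4 - 1 - p 0, p 1, p 2]

theorem isPolyMap_slaterInv : IsPolyMap slaterInv :=
  ⟨![.X 3 - 1 - .X 0, .X 4 - 1 - .X 0, .X 1, .X 2],
    fun x k => by fin_cases k <;> simp [slaterInv]⟩

theorem slaterMap_slaterInv {p : Fin 5 → ℂ} (hp : p ∈ slaterVariety) :
    slaterMap (slaterInv p) = p := by
  obtain ⟨-, h⟩ := hp
  ext k
  fin_cases k <;> simp [slaterMap, slaterInv] <;> linear_combination -h

theorem slaterInv_mem {p : Fin 5 → ℂ} (hp : p ∈ slaterVariety) :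
    slaterInv p 0 * slaterInv p 1 = slaterInv p 2 * slaterInv p 3 := by
  obtain ⟨h1, h2⟩ := hp
  simp [slaterInv]
  linear_combination -h1 - p 0 * h2

theorem slaterMap_mem {y : Fin 4 → ℂ} (hy : y 0 * y 1 = y 2 * y 3) :
    slaterMap y ∈ slaterVariety := by
  constructor
  · simp [slaterMap]
    linear_combination -hy
  · simp [slaterMap]
    ring

/-- The Segre parametrization of the quadric `PQ = bc`. -/
def segreMap (t : Fin 4 → ℂ) : Fin 4 → ℂ :=
  ![t 0 * t 1, t 2 * t 3, t 0 * t 2, t 1 * t 3]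

theorem isPolyMap_segreMap : IsPolyMap segreMap :=
  ⟨![.X 0 * .X 1, .X 2 * .X 3, .X 0 * .X 2, .X 1 * .X 3],
    fun x k => by fin_cases k <;> simp [segreMap]⟩

/-- A singular `2 × 2` matrix is an outer product: here `!![y 0, y 2; y 3, y 1]` is the column `(t
0, t 3)` times the row `(t 1, t 2)`. -/
theorem exists_segreMap_eq {y : Fin 4 → ℂ} (hy : y 0 * y 1 = y 2 * y 3) :
    ∃ t, segreMap t = y := by
  by_cases h0 : y 0 = 0
  · by_cases h2 : y 2 = 0
    · refine ⟨![0, y 3, y 1, 1], ?_⟩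
      ext k
      fin_cases k <;> simp [segreMap, h0, h2]
    · refine ⟨![1, y 0, y 2, y 1 / y 2], ?_⟩
      ext k
      fin_cases k <;> simp [segreMap] <;> field_simp
      exact hy
  · refine ⟨![1, y 0, y 2, y 3 / y 0], ?_⟩
    ext k
    fin_cases k <;> simp [segreMap] <;> field_simp
    exact hy.symm

/-- This polynomial parametrization gives the irreducibility of the Slater variety. -/
theorem slaterVariety_eq_range : slaterVariety = Set.range (slaterMap ∘ segreMap) := by
  ext p
  constructor
  · intro hp
    obtain ⟨t, ht⟩ := exists_segreMap_eq (slaterInv_mem hp)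
    exact ⟨t, by rw [Function.comp_apply, ht, slaterMap_slaterInv hp]⟩
  · rintro ⟨t, rfl⟩
    refine slaterMap_mem ?_
    simp [segreMap]
    ring

/-- The upper bound comes from a proper hypersurface in `ℂ^4`; the lower bound from the 2-plane
`overlapPlane` lying properly inside an irreducible variety. -/
theorem varietyDim_slaterVariety : varietyDim slaterVariety = 3 := by
  refine le_antisymm ?_ ?_
  · have h1 : varietyDim slaterVariety ≤
        coordDim {y : Fin 4 → ℂ | MvPolynomial.aeval y
          (.X 0 * .X 1 - .X 2 * .X 3 : MvPolynomial (Fin 4) ℂ) = 0} := by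
      refine coordDim_le_of_leftInverse isPolyMap_slaterInv isPolyMap_slaterMap
        (fun p hp => ?_) fun p hp => slaterMap_slaterInv hp
      simpa [sub_eq_zero] using slaterInv_mem hp
    have h2 := coordDim_add_one_le_card (k := 4)
      (P := .X 0 * .X 1 - .X 2 * .X 3) (fun x hx => hx) (y := ![1, 1, 0, 0]) (by simp)
    rw [show ((4 : ℕ) : WithBot ℕ∞) = 3 + 1 by norm_num] at h2
    exact h1.trans (ENat.WithBot.add_le_add_one_right_iff.1 h2)
  · have hsub : overlapPlane ⊆ slaterVariety := by
      rw [← slaterVariety_inter_dixonPlane]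
      exact Set.inter_subset_left
    have h := coordDim_add_one_le hsub
      (by
        rw [slaterVariety_eq_range]
        exact vanishingIdeal_range_isPrime (isPolyMap_slaterMap.comp isPolyMap_segreMap))
      -- This form vanishes on `overlapPlane` but not at the chosen point of the Slater variety.
      (P := .X 0 - 2 * .X 1 - 2 * .X 2) (y := ![-1, 0, 0, 1, 0]) ?_ ?_ ?_
    · rw [show coordDim overlapPlane = 2 from varietyDim_overlapPlane] at h
      exact le_of_eq_of_le (by norm_num) h
    · rintro _ ⟨b, c, rfl⟩
      simp [overlapPoint, map_ofNat]
    · constructor <;> simp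
      norm_num
    · simp

/-! ### Proper and improper intersections of the orbits. -/

theorem orbitsIntersectImproperly_slater_dixon :
    OrbitsIntersectImproperly slaterOrbit dixonWatsonWhippleOrbit := by
  refine ⟨_, self_mem_thomaeOrbit _, _, self_mem_thomaeOrbit _, overlapPlane, ⟨?_, ?_, ?_⟩, ?_⟩
  · exact isIrreducibleVariety_overlapPlane
  · rw [slaterVariety_inter_dixonPlane]
  · intro Z _ h1 h2
    rw [slaterVariety_inter_dixonPlane] at h2
    exact h2.antisymm h1
  · rw [varietyDim_slaterVariety, varietyDim_dixonPlane, varietyDim_overlapPlane]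
    exact_mod_cast (by norm_num : (3 + 3 : ℕ) < 2 + 5)

theorem not_orbitsIntersectImproperly {S S' : Set (Fin 5 → ℂ)} (hS : varietyDim S = 3)
    (hS' : varietyDim S' = 3)
    (h : ∀ ρ : Equiv.Perm (Fin 5),
      coordDim {r : Fin 5 → ℂ | (r ∘ ρ) ᵥ* thomaeA ∈ S ∧ r ᵥ* thomaeA ∈ S'} ≤ 1) :
    ¬ OrbitsIntersectImproperly (thomaeOrbit S) (thomaeOrbit S') := by
  rintro ⟨V, hV, W, hW, Z, hZ, hlt⟩
  obtain ⟨ρ, hρ⟩ := exists_perm_coordDim_le hV hW hZ.2.1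
  rw [varietyDim_eq_of_mem_thomaeOrbit hV, varietyDim_eq_of_mem_thomaeOrbit hW, hS, hS'] at hlt
  have h1 : varietyDim Z + 5 ≤ 1 + 5 := by
    gcongr
    exact hρ.trans (h ρ)
  refine (hlt.trans_le h1).ne ?_
  norm_num

theorem not_orbitsIntersectImproperly_slater_pfaffSaalschutz (n : ℕ) :
    ¬ OrbitsIntersectImproperly slaterOrbit (pfaffSaalschutzOrbit n) := by
  refine not_orbitsIntersectImproperly varietyDim_slaterVariety
    (varietyDim_pfaffSaalschutzPlane n) fun ρ => ?_
  refine (coordDim_mono ?_).trans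
    (coordDim_slaterCoords_inter_le n (ρ.injective.ne (show (3 : Fin 5) ≠ 4 by decide)))
  rintro r ⟨h1, h2⟩
  obtain ⟨h3, h4⟩ := vecMul_thomaeA_mem_slaterVariety h1
  refine ⟨?_, vecMul_thomaeA_mem_pfaffSaalschutzPlane h2⟩
  have h5 := Equiv.sum_comp ρ r
  have h6 := Equiv.sum_comp ρ (fun i => r i ^ 2)
  rw [Fin.sum_univ_five] at h5 h6
  simp only [Function.comp_apply] at h3 h4
  exact ⟨by linear_combination h3 - h5, by linear_combination h4 + h6⟩

theorem not_orbitsIntersectImproperly_dixon_pfaffSaalschutz (n : ℕ) :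
    ¬ OrbitsIntersectImproperly dixonWatsonWhippleOrbit (pfaffSaalschutzOrbit n) := by
  refine not_orbitsIntersectImproperly varietyDim_dixonPlane
    (varietyDim_pfaffSaalschutzPlane n) fun ρ => ?_
  have hρ : ∀ {i j : Fin 5}, i ≠ j → ρ i ≠ ρ j := ρ.injective.ne
  refine (coordDim_mono ?_).trans (coordDim_dixonCoords_inter_le n
    (hρ (show (1 : Fin 5) ≠ 3 by decide)) (hρ (show (1 : Fin 5) ≠ 2 by decide))
    (hρ (show (1 : Fin 5) ≠ 4 by decide)) (hρ (show (3 : Fin 5) ≠ 2 by decide))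
    (hρ (show (3 : Fin 5) ≠ 4 by decide)) (hρ (show (2 : Fin 5) ≠ 4 by decide)))
  rintro r ⟨h1, h2⟩
  exact ⟨vecMul_thomaeA_mem_dixonPlane h1, vecMul_thomaeA_mem_pfaffSaalschutzPlane h2⟩

/-! ### Slater's summation formula by telescoping. -/

/-- The limit holds at the poles of `Complex.Gamma` too: there division by zero makes `GammaSeq`
eventually 0, matching the value 0 of `Complex.Gamma` and the convention for `1 / Γ`. -/
theorem tendsto_inv_GammaSeq (s : ℂ) :
    Filter.Tendsto (fun n => (Complex.GammaSeq s n)⁻¹) Filter.atTop (nhds (Complex.Gamma s)⁻¹) := by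
  by_cases h : Complex.Gamma s = 0
  · obtain ⟨m, rfl⟩ := (Complex.Gamma_eq_zero_iff s).1 h
    rw [h, inv_zero]
    refine tendsto_const_nhds.congr' ?_
    filter_upwards [Filter.eventually_ge_atTop m] with n hn
    have h0 : ∏ j ∈ Finset.range (n + 1), (-(m : ℂ) + j) = 0 :=
      Finset.prod_eq_zero (Finset.mem_range.2 (Nat.lt_succ_of_le hn)) (by ring)
    rw [Complex.GammaSeq, h0, div_zero, inv_zero]
  · exact (Complex.GammaSeq_tendsto_Gamma s).inv₀ h

theorem ascPochhammer_eval_eq_prod (s : ℂ) (n : ℕ) :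
    (ascPochhammer ℂ n).eval s = ∏ j ∈ Finset.range n, (s + j) := by
  induction n with
  | zero => simp
  | succ n ih => rw [ascPochhammer_succ_eval, ih, Finset.prod_range_succ]

theorem ascPochhammer_eval_eq_GammaSeq (s : ℂ) {n : ℕ} (hn : n ≠ 0) :
    (ascPochhammer ℂ (n + 1)).eval s =
      (n : ℂ) ^ s * n.factorial * (Complex.GammaSeq s n)⁻¹ := by
  have h1 : (n : ℂ) ^ s ≠ 0 := by simp [Complex.cpow_eq_zero_iff, hn]
  have h2 : (n.factorial : ℂ) ≠ 0 := by exact_mod_cast n.factorial_ne_zero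
  rw [ascPochhammer_eval_eq_prod, Complex.GammaSeq, inv_div, mul_div_cancel₀ _ (mul_ne_zero h1 h2)]

theorem ascPochhammer_succ_left_eval (s : ℂ) (n : ℕ) :
    (ascPochhammer ℂ (n + 1)).eval s = s * (ascPochhammer ℂ n).eval (1 + s) := by
  rw [ascPochhammer_succ_left]
  simp [add_comm]

theorem ascPochhammer_eval_mul_add (s : ℂ) (n : ℕ) :
    (ascPochhammer ℂ n).eval s * (s + n) = s * (ascPochhammer ℂ n).eval (1 + s) := by
  rw [← ascPochhammer_succ_eval, ascPochhammer_succ_left_eval]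

theorem ascPochhammer_eval_ne_zero {s : ℂ} (hs : ∀ m : ℕ, s ≠ -(m : ℂ)) (n : ℕ) :
    (ascPochhammer ℂ n).eval s ≠ 0 := by
  rw [Ne, ascPochhammer_eval_eq_zero_iff]
  rintro ⟨k, -, hk⟩
  exact hs k (by rw [hk, neg_neg])

/-- The value `(1 + a)ₙ (1 + b)ₙ (1 + c)ₙ / ((d)ₙ (e)ₙ n!)` of the partial sums of Slater's
series. -/
noncomputable def slaterPartialSum (p : Fin 5 → ℂ) (n : ℕ) : ℂ :=
  ((ascPochhammer ℂ n).eval (1 + p 0) * (ascPochhammer ℂ n).eval (1 + p 1) *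
      (ascPochhammer ℂ n).eval (1 + p 2)) /
    ((ascPochhammer ℂ n).eval (p 3) * (ascPochhammer ℂ n).eval (p 4) * (n.factorial : ℂ))

/-- Once the partial sums are known to be bounded, this shows that the terms are `O(n⁻³)`. -/
theorem threeFTwoTerm_mul (p : Fin 5 → ℂ) (n : ℕ) :
    threeFTwoTerm p n * ((p 0 + n) * (p 1 + n) * (p 2 + n)) =
      p 0 * p 1 * p 2 * slaterPartialSum p n := by
  have h0 := ascPochhammer_eval_mul_add (p 0) n
  have h1 := ascPochhammer_eval_mul_add (p 1) n
  have h2 := ascPochhammer_eval_mul_add (p 2) n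
  rw [threeFTwoTerm, slaterPartialSum, div_mul_eq_mul_div, ← mul_div_assoc]
  congr 1
  linear_combination ((ascPochhammer ℂ n).eval (p 1) * (p 1 + n) *
    ((ascPochhammer ℂ n).eval (p 2) * (p 2 + n))) * h0 +
    (p 0 * (ascPochhammer ℂ n).eval (1 + p 0)) * ((ascPochhammer ℂ n).eval (p 2) * (p 2 + n)) * h1 +
    (p 0 * (ascPochhammer ℂ n).eval (1 + p 0)) * (p 1 * (ascPochhammer ℂ n).eval (1 + p 1)) * h2

theorem sum_threeFTwoTerm {p : Fin 5 → ℂ} (hp : p ∈ slaterVariety)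
    (hd : ∀ m : ℕ, p 3 ≠ -(m : ℂ)) (he : ∀ m : ℕ, p 4 ≠ -(m : ℂ)) (n : ℕ) :
    ∑ k ∈ Finset.range (n + 1), threeFTwoTerm p k = slaterPartialSum p n := by
  obtain ⟨hq, hl⟩ := hp
  induction n with
  | zero => simp [threeFTwoTerm, slaterPartialSum]
  | succ n ih =>
    rw [Finset.sum_range_succ, ih]
    have hdn := ascPochhammer_eval_ne_zero hd n
    have hen := ascPochhammer_eval_ne_zero he n
    have hdn' : p 3 + n ≠ 0 := fun h => hd n (eq_neg_of_add_eq_zero_left h)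
    have hen' : p 4 + n ≠ 0 := fun h => he n (eq_neg_of_add_eq_zero_left h)
    have hf : (n.factorial : ℂ) ≠ 0 := by exact_mod_cast n.factorial_ne_zero
    have hn : (n : ℂ) + 1 ≠ 0 := Nat.cast_add_one_ne_zero n
    -- Expanded in powers of `n + 1`, the two sides have equal coefficients exactly by the two
    -- equations of the Slater variety. This identity is the telescoping step.
    have key : (1 + p 0 + n) * (1 + p 1 + n) * (1 + p 2 + n) =
        (p 3 + n) * (p 4 + n) * (n + 1) + p 0 * p 1 * p 2 := by
      linear_combination ((n : ℂ) + 1) * hq - ((n : ℂ) + 1) ^ 2 * hl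
    rw [threeFTwoTerm, slaterPartialSum, slaterPartialSum, ascPochhammer_succ_left_eval (p 0),
      ascPochhammer_succ_left_eval (p 1), ascPochhammer_succ_left_eval (p 2)]
    simp only [ascPochhammer_succ_eval, Nat.factorial_succ, Nat.cast_mul, Nat.cast_succ]
    generalize (ascPochhammer ℂ n).eval (p 3) = D at hdn ⊢
    generalize (ascPochhammer ℂ n).eval (p 4) = E at hen ⊢
    generalize (ascPochhammer ℂ n).eval (1 + p 0) = N₀
    generalize (ascPochhammer ℂ n).eval (1 + p 1) = N₁
    generalize (ascPochhammer ℂ n).eval (1 + p 2) = N₂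
    rw [div_add_div _ _ (by simp [*]) (by simp [*]),
      div_eq_div_iff (by simp [*]) (by simp [*])]
    linear_combination (-(N₀ * N₁ * N₂) * (D * E * n.factorial) ^ 2 *
      ((p 3 + n) * (p 4 + n) * (n + 1))) * key

theorem tendsto_slaterPartialSum {p : Fin 5 → ℂ} (hl : p 3 + p 4 - p 0 - p 1 - p 2 = 2) :
    Filter.Tendsto (slaterPartialSum p) Filter.atTop
      (nhds (Complex.Gamma (p 3) * Complex.Gamma (p 4) /
        (Complex.Gamma (1 + p 0) * Complex.Gamma (1 + p 1) * Complex.Gamma (1 + p 2)))) := by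
  -- The index is shifted because `GammaSeq s n` has `n + 1` factors in its denominator.
  rw [← Filter.tendsto_add_atTop_iff_nat 1]
  have h := (((tendsto_inv_GammaSeq (1 + p 0)).mul (tendsto_inv_GammaSeq (1 + p 1))).mul
    (tendsto_inv_GammaSeq (1 + p 2))).mul (((Complex.GammaSeq_tendsto_Gamma (p 3)).mul
      (Complex.GammaSeq_tendsto_Gamma (p 4))).mul (Complex.GammaSeq_tendsto_Gamma 1))
  rw [Complex.Gamma_one] at h
  convert! h.congr' ?_ using 2
  · rw [mul_one, mul_comm, div_eq_mul_inv, mul_inv, mul_inv, mul_comm]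
  · filter_upwards [Filter.eventually_ne_atTop 0] with n hn
    have hn' : (n : ℂ) ≠ 0 := Nat.cast_ne_zero.2 hn
    have hf : (n.factorial : ℂ) ≠ 0 := by exact_mod_cast n.factorial_ne_zero
    have hc : ∀ s : ℂ, (n : ℂ) ^ s ≠ 0 := fun s => by simp [Complex.cpow_eq_zero_iff, hn]
    -- The powers of `n` cancel because the linear Slater equation makes the two exponent sums
    -- equal, with `n!` counted as the Pochhammer symbol at 1.
    have hpow : (n : ℂ) ^ (1 + p 0) * (n : ℂ) ^ (1 + p 1) * (n : ℂ) ^ (1 + p 2) =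
        (n : ℂ) ^ p 3 * (n : ℂ) ^ p 4 * (n : ℂ) ^ (1 : ℂ) := by
      rw [← Complex.cpow_add _ _ hn', ← Complex.cpow_add _ _ hn', ← Complex.cpow_add _ _ hn',
        ← Complex.cpow_add _ _ hn']
      congr 1
      linear_combination -hl
    have hfac : ((n + 1).factorial : ℂ) = (ascPochhammer ℂ (n + 1)).eval 1 :=
      Nat.cast_factorial ℂ (n + 1)
    rw [slaterPartialSum, hfac]
    simp only [ascPochhammer_eval_eq_GammaSeq _ hn]
    have hone : (n : ℂ) ^ (1 + p 0) * (n : ℂ) ^ (1 + p 1) * (n : ℂ) ^ (1 + p 2) *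
        (n.factorial : ℂ) ^ 3 / ((n : ℂ) ^ p 3 * (n : ℂ) ^ p 4 * (n : ℂ) ^ (1 : ℂ) *
          (n.factorial : ℂ) ^ 3) = 1 := by
      rw [hpow]
      exact div_self (mul_ne_zero (mul_ne_zero (mul_ne_zero (hc _) (hc _)) (hc _))
        (pow_ne_zero _ hf))
    generalize (n : ℂ) ^ (1 + p 0) = P₀ at hone ⊢
    generalize (n : ℂ) ^ (1 + p 1) = P₁ at hone ⊢
    generalize (n : ℂ) ^ (1 + p 2) = P₂ at hone ⊢
    generalize (n : ℂ) ^ p 3 = P₃ at hone ⊢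
    generalize (n : ℂ) ^ p 4 = P₄ at hone ⊢
    generalize (n : ℂ) ^ (1 : ℂ) = P₅ at hone ⊢
    refine ((one_mul _).symm.trans (congrArg (· * _) hone.symm)).trans ?_
    simp only [div_eq_mul_inv, mul_inv, inv_inv]
    ring

theorem isBigO_inv_add_natCast (a : ℂ) :
    (fun n : ℕ => (a + n)⁻¹) =O[Filter.atTop] fun n : ℕ => (n : ℝ)⁻¹ := by
  refine Asymptotics.IsBigO.of_bound 2 ?_
  filter_upwards [Filter.eventually_ge_atTop (⌈2 * ‖a‖⌉₊ + 1)] with n hn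
  have h1 : 2 * ‖a‖ + 1 ≤ n := (add_le_add_left (Nat.le_ceil _) 1).trans (by exact_mod_cast hn)
  have h2 : (n : ℝ) - ‖a‖ ≤ ‖a + n‖ := by
    have := norm_sub_norm_le (n : ℂ) (-a)
    rwa [sub_neg_eq_add, norm_neg, Complex.norm_natCast, add_comm (n : ℂ)] at this
  have h3 : 0 ≤ ‖a‖ := norm_nonneg a
  have h4 : (0 : ℝ) < n := by linarith
  rw [norm_inv, norm_inv, Real.norm_natCast, ← div_eq_mul_inv,
    inv_le_comm₀ (by linarith)
    (by positivity), inv_div]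
  linarith

theorem hasSum_threeFTwoTerm_of_mem_slaterVariety {p : Fin 5 → ℂ} (hp : p ∈ slaterVariety)
    (hd : ∀ m : ℕ, p 3 ≠ -(m : ℂ)) (he : ∀ m : ℕ, p 4 ≠ -(m : ℂ)) :
    HasSum (threeFTwoTerm p) (Complex.Gamma (p 3) * Complex.Gamma (p 4) /
      (Complex.Gamma (1 + p 0) * Complex.Gamma (1 + p 1) * Complex.Gamma (1 + p 2))) := by
  have hlim := tendsto_slaterPartialSum hp.2
  have hO : threeFTwoTerm p =O[Filter.atTop] fun n : ℕ => ((n : ℝ) ^ 3)⁻¹ := by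
    have h := (((hlim.const_mul (p 0 * p 1 * p 2)).isBigO_one ℝ).mul
      (((isBigO_inv_add_natCast (p 0)).mul (isBigO_inv_add_natCast (p 1))).mul
        (isBigO_inv_add_natCast (p 2))))
    refine h.congr' ?_ (Filter.Eventually.of_forall fun n => ?_)
    · have hne : ∀ a : ℂ, ∀ᶠ n : ℕ in Filter.atTop, a + n ≠ 0 := fun a => by
        filter_upwards [Filter.eventually_gt_atTop ⌈‖a‖⌉₊] with n hn h
        have : ‖a‖ = n := by
          rw [eq_neg_of_add_eq_zero_left h, norm_neg, Complex.norm_natCast]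
        rw [this, Nat.ceil_natCast] at hn
        exact lt_irrefl _ hn
      -- The identity `threeFTwoTerm_mul` may be divided by the three factors once `n` is past their
      -- possible zeros.
      filter_upwards [hne (p 0), hne (p 1), hne (p 2)] with n h0 h1 h2
      rw [← threeFTwoTerm_mul]
      field_simp
    · simp only [one_mul]
      ring
  have hs : Summable (threeFTwoTerm p) :=
    summable_of_isBigO_nat (Real.summable_nat_pow_inv.2 (by norm_num)) hO
  refine (hs.hasSum_iff_tendsto_nat).2 ((Filter.tendsto_add_atTop_iff_nat 1).1 ?_)
  exact hlim.congr fun n => (sum_threeFTwoTerm hp hd he n).symm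

theorem mainTheorem9 :
    -- all varieties on the orbits are three-dimensional
    (∀ V ∈ slaterOrbit, varietyDim V = 3) ∧
    (∀ V ∈ dixonWatsonWhippleOrbit, varietyDim V = 3) ∧
    (∀ n : ℕ, 1 ≤ n → ∀ V ∈ pfaffSaalschutzOrbit n, varietyDim V = 3) ∧
    -- (i), with the common two-parameter specialization
    (OrbitsIntersectImproperly slaterOrbit dixonWatsonWhippleOrbit ∧
      IsIrreducibleVariety overlapPlane ∧
      varietyDim overlapPlane = 2 ∧
      overlapPlane ⊆ slaterVariety ∩ dixonPlane ∧
      ∀ b c : ℂ, (∀ m : ℕ, 1 + b + 2 * c ≠ -(m : ℂ)) → (∀ m : ℕ, 1 + 2 * b + c ≠ -(m : ℂ)) →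
        HasSum (threeFTwoTerm (overlapPoint b c))
          (Complex.Gamma (1 + b + 2 * c) * Complex.Gamma (1 + 2 * b + c) /
            (Complex.Gamma (1 + 2 * b + 2 * c) * Complex.Gamma (1 + b) *
              Complex.Gamma (1 + c)))) ∧
    -- (ii)
    (∀ n : ℕ, 1 ≤ n → ¬ OrbitsIntersectImproperly slaterOrbit (pfaffSaalschutzOrbit n)) ∧
    -- (iii)
    (∀ n : ℕ, 1 ≤ n →
      ¬ OrbitsIntersectImproperly dixonWatsonWhippleOrbit (pfaffSaalschutzOrbit n)) := by
  refine ⟨fun V hV => ?_, fun V hV => ?_, fun n _ V hV => ?_,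
    ⟨orbitsIntersectImproperly_slater_dixon, isIrreducibleVariety_overlapPlane,
      varietyDim_overlapPlane, slaterVariety_inter_dixonPlane.ge, fun b c hd he => ?_⟩,
    fun n _ => not_orbitsIntersectImproperly_slater_pfaffSaalschutz n,
    fun n _ => not_orbitsIntersectImproperly_dixon_pfaffSaalschutz n⟩
  · rw [varietyDim_eq_of_mem_thomaeOrbit hV, varietyDim_slaterVariety]
  · rw [varietyDim_eq_of_mem_thomaeOrbit hV, varietyDim_dixonPlane]
  · rw [varietyDim_eq_of_mem_thomaeOrbit hV, varietyDim_pfaffSaalschutzPlane]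
  · have hmem : overlapPoint b c ∈ slaterVariety :=
      (slaterVariety_inter_dixonPlane.ge (⟨b, c, rfl⟩ : overlapPoint b c ∈ overlapPlane)).1
    have h := hasSum_threeFTwoTerm_of_mem_slaterVariety hmem hd he
    simpa [overlapPoint, add_assoc] using h
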